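/- Let $n\ge 1$ be an integer and let $p:GL(n,\mathbb C)\to PGL(n,\mathbb C)$ be the projection. A subgroup of $PGL(n,\mathbb C)$ is called diagonalizable if it is abelian and consists of semisimple elements, i.e. elements $p(g)$ for which the map $X\mapsto gXg^{-1}$ on $M(n,\mathbb C)$ is semisimple. A finite maximal diagonalizable subgroup is a finite subgroup that is maximal, with respect to inclusion, among all diagonalizable subgroups of $PGL(n,\mathbb C)$. For such a subgroup $K$, the commutator pairing $\langle\cdot,\cdot\rangle_K:K\times K\to\mathbb C^\times$ is defined by $\tilde\sigma\tilde\tau\tilde\sigma^{-1}\tilde\tau^{-1}=\langle\sigma,\tau\rangle_K I_n$, where $\tilde\sigma\in p^{-1}(\sigma)$ and $\tilde\tau\in p^{-1}(\tau)$; it does not depend on the choice of $\tilde\sigma,\tilde\tau$. A symplectic abelian group is an abelian group $H$ with a $\mathbb Z$-bilinear pairing $\langle\cdot,\cdot\rangle:H\times H\to\mathbb C^\times$ which is alternating, i.e. $\langle a,a\rangle=1$ for all $a\in H$ (hence $\langle a,b\rangle=\langle b,a\rangle^{-1}$ for all $a,b\in H$). It is nonsingular if the only $a\in H$ with $\langle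 a,b\rangle=1$ for all $b\in H$ is the identity element. Two symplectic abelian groups are isometric if there is a group isomorphism between them that preserves the pairings. Proposition. For every finite maximal diagonalizable subgroup $K$ of $PGL(n,\mathbb C)$, $(K,\langle\cdot,\cdot\rangle_K)$ is a nonsingular symplectic abelian group of order $n^2$, and the assignment $K\mapsto(K,\langle\cdot,\cdot\rangle_K)$ induces a well-defined bijection from the set of conjugacy classes of finite maximal diagonalizable subgroups of $PGL(n,\mathbb C)$ to the set of isometry classes of nonsingular symplectic abelian groups of order $n^2$. -/

import Mathlib

universe u v

/-! ### Symplectic abelian groups -/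

/-- A symplectic abelian group (written multiplicatively): an abelian group `H` with a
`ℤ`-bilinear pairing `H × H → ℂˣ` which is alternating, `⟨a, a⟩ = 1`.  Bilinearity is encoded by
the type of `pairing`; the anti-symmetry `⟨a, b⟩ = ⟨b, a⟩⁻¹` follows, see `pairing_antisymm`. -/
structure SymplecticAbelianGroup : Type (u + 1) where
  carrier : Type u
  [commGroup : CommGroup carrier]
  pairing : carrier →* carrier →* ℂˣ
  pairing_self : ∀ a, pairing a a = 1

namespace SymplecticAbelianGroup

attribute [instance] commGroup

theorem pairing_antisymm (H : SymplecticAbelianGroup.{u}) (a b : H.carrier) :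
    H.pairing a b = (H.pairing b a)⁻¹ := by
  have h := H.pairing_self (a * b)
  simp only [map_mul, MonoidHom.mul_apply, pairing_self, one_mul, mul_one] at h
  exact eq_inv_of_mul_eq_one_right h

/-- The pairing is nonsingular: `⟨a, b⟩ = 1` for all `b` implies that `a` is the identity. -/
def Nonsingular (H : SymplecticAbelianGroup.{u}) : Prop :=
  ∀ a : H.carrier, (∀ b, H.pairing a b = 1) → a = 1

/-- Two symplectic abelian groups are isometric if some group isomorphism between them
preserves the pairings. -/
def Isometric (H₁ : SymplecticAbelianGroup.{u}) (H₂ : SymplecticAbelianGroup.{v}) : Prop :=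
  ∃ e : H₁.carrier ≃* H₂.carrier, ∀ a b, H₂.pairing (e a) (e b) = H₁.pairing a b

theorem Isometric.refl (H : SymplecticAbelianGroup.{u}) : Isometric H H :=
  ⟨MulEquiv.refl _, fun _ _ => rfl⟩

theorem Isometric.symm {H₁ : SymplecticAbelianGroup.{u}} {H₂ : SymplecticAbelianGroup.{v}}
    (h : Isometric H₁ H₂) : Isometric H₂ H₁ := by
  obtain ⟨e, he⟩ := h
  exact ⟨e.symm, fun a b => by simpa using (he (e.symm a) (e.symm b)).symm⟩

theorem Isometric.trans {H₁ H₂ H₃ : SymplecticAbelianGroup.{u}}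
    (h : Isometric H₁ H₂) (h' : Isometric H₂ H₃) : Isometric H₁ H₃ := by
  obtain ⟨e, he⟩ := h
  obtain ⟨e', he'⟩ := h'
  exact ⟨e.trans e', fun a b => by simp [he, he']⟩

end SymplecticAbelianGroup

/-- The nonsingular symplectic abelian groups of order `m` (a finite group when `m ≠ 0`). -/
def NonsingularSymplecticOfOrder (m : ℕ) : Type (u + 1) :=
  {H : SymplecticAbelianGroup.{u} // H.Nonsingular ∧ Nat.card H.carrier = m}

/-- Isometry as an equivalence relation. -/
def isometrySetoid (m : ℕ) : Setoid (NonsingularSymplecticOfOrder.{u} m) where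
  r H₁ H₂ := SymplecticAbelianGroup.Isometric H₁.1 H₂.1
  iseqv := ⟨fun H => .refl H.1, fun h => h.symm, fun h h' => h.trans h'⟩

/-- The isometry classes of nonsingular symplectic abelian groups of order `m`. -/
def IsometryClasses (m : ℕ) : Type (u + 1) :=
  Quotient (isometrySetoid.{u} m)

/-! ### Diagonalizable subgroups of `PGL(n, ℂ)` -/

/-- The adjoint action `X ↦ g X g⁻¹` of `GL(n, ℂ)` on `M(n, ℂ)`. -/
def adjointAction {n : ℕ} (g : Matrix.GeneralLinearGroup (Fin n) ℂ) :
    Module.End ℂ (Matrix (Fin n) (Fin n) ℂ) :=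
  LinearMap.mulLeftRight ℂ
    ((g : Matrix (Fin n) (Fin n) ℂ), ((g⁻¹ : Matrix.GeneralLinearGroup (Fin n) ℂ) : Matrix _ _ ℂ))

theorem adjointAction_apply {n : ℕ} (g : Matrix.GeneralLinearGroup (Fin n) ℂ)
    (X : Matrix (Fin n) (Fin n) ℂ) :
    adjointAction g X = (g : Matrix (Fin n) (Fin n) ℂ) * X *
      ((g⁻¹ : Matrix.GeneralLinearGroup (Fin n) ℂ) : Matrix _ _ ℂ) := by
  simp [adjointAction]

/-- An element of `PGL(n, ℂ)` is semisimple if it acts semisimply on `M(n, ℂ)` (equivalently,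
on `sl(n, ℂ)`) by the adjoint action.  That action does not depend on the lift `g`. -/
def IsSemisimpleElement {n : ℕ} (σ : Matrix.ProjGenLinGroup (Fin n) ℂ) : Prop :=
  ∀ g : Matrix.GeneralLinearGroup (Fin n) ℂ, Matrix.ProjGenLinGroup.mk g = σ →
    (adjointAction g).IsSemisimple

/-- A subgroup of `PGL(n, ℂ)` is diagonalizable if it is abelian and consists of semisimple
elements. -/
structure IsDiagonalizableSubgroup {n : ℕ}
    (K : Subgroup (Matrix.ProjGenLinGroup (Fin n) ℂ)) : Prop where
  comm : ∀ σ ∈ K, ∀ τ ∈ K, σ * τ = τ * σ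
  semisimple : ∀ σ ∈ K, IsSemisimpleElement σ

/-- The finite subgroups of `PGL(n, ℂ)` that are maximal (for inclusion) among all
diagonalizable subgroups, finite or not. -/
def FiniteMaximalDiagonalizable (n : ℕ) : Type :=
  {K : Subgroup (Matrix.ProjGenLinGroup (Fin n) ℂ) //
    Maximal IsDiagonalizableSubgroup K ∧ Finite K}

/-- Conjugacy in `PGL(n, ℂ)` as an equivalence relation. -/
def conjugacySetoid (n : ℕ) : Setoid (FiniteMaximalDiagonalizable n) where
  r K₁ K₂ := ∃ g : Matrix.ProjGenLinGroup (Fin n) ℂ,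
    K₁.1.map (MulAut.conj g).toMonoidHom = K₂.1
  iseqv :=
    { refl := fun K => ⟨1, by
        ext x
        simp [Subgroup.mem_map]⟩
      symm := by
        rintro K₁ K₂ ⟨g, hg⟩
        refine ⟨g⁻¹, ?_⟩
        rw [← hg, Subgroup.map_map]
        ext x
        simp [Subgroup.mem_map, mul_assoc]
      trans := by
        rintro K₁ K₂ K₃ ⟨g, hg⟩ ⟨h, hh⟩
        refine ⟨h * g, ?_⟩
        rw [← hh, ← hg, Subgroup.map_map]
        ext x
        simp [Subgroup.mem_map, mul_assoc] }

/-- The conjugacy classes of finite maximal diagonalizable subgroups of `PGL(n, ℂ)`. -/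
def ConjugacyClasses (n : ℕ) : Type :=
  Quotient (conjugacySetoid n)

/-! ### The commutator pairing -/

section CommutatorPairing

variable {n : ℕ}

theorem exists_commutator_eq_scalar (g h : Matrix.GeneralLinearGroup (Fin n) ℂ)
    (hc : Matrix.ProjGenLinGroup.mk g * Matrix.ProjGenLinGroup.mk h =
      Matrix.ProjGenLinGroup.mk h * Matrix.ProjGenLinGroup.mk g) :
    ∃ l : ℂˣ, g * h * g⁻¹ * h⁻¹ = Matrix.GeneralLinearGroup.scalar (Fin n) l := by
  have h1 : Matrix.ProjGenLinGroup.mk (g * h * g⁻¹ * h⁻¹) = 1 := by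
    simp only [map_mul, map_inv]
    rw [hc]
    group
  rw [Matrix.ProjGenLinGroup.mk_eq_one, Matrix.GeneralLinearGroup.center_eq_range_scalar] at h1
  obtain ⟨l, hl⟩ := h1
  exact ⟨l, hl.symm⟩

/-- A fixed preimage of `σ` in `GL(n, ℂ)`. -/
noncomputable def chosenLift (σ : Matrix.ProjGenLinGroup (Fin n) ℂ) :
    Matrix.GeneralLinearGroup (Fin n) ℂ :=
  (Matrix.ProjGenLinGroup.mk_surjective σ).choose

theorem mk_chosenLift (σ : Matrix.ProjGenLinGroup (Fin n) ℂ) :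
    Matrix.ProjGenLinGroup.mk (chosenLift σ) = σ :=
  (Matrix.ProjGenLinGroup.mk_surjective σ).choose_spec

/-- For commuting `σ`, `τ` in `PGL(n, ℂ)` with preimages `s`, `t` in `GL(n, ℂ)`, the scalar `l`
with `s t s⁻¹ t⁻¹ = l Iₙ`. -/
noncomputable def commutatorScalar (σ τ : Matrix.ProjGenLinGroup (Fin n) ℂ)
    (hc : σ * τ = τ * σ) : ℂˣ :=
  (exists_commutator_eq_scalar (chosenLift σ) (chosenLift τ)
    (by simpa only [mk_chosenLift] using hc)).choose

theorem scalar_injective [NeZero n] :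
    Function.Injective (Matrix.GeneralLinearGroup.scalar (Fin n) : ℂˣ → _) := by
  intro a b hab
  have := congrArg (fun M : Matrix.GeneralLinearGroup (Fin n) ℂ =>
    (M : Matrix (Fin n) (Fin n) ℂ) 0 0) hab
  exact Units.ext (by simpa using this)

theorem scalar_comm (z : ℂˣ) (g : Matrix.GeneralLinearGroup (Fin n) ℂ) :
    Matrix.GeneralLinearGroup.scalar (Fin n) z * g =
      g * Matrix.GeneralLinearGroup.scalar (Fin n) z := by
  have hz : Matrix.GeneralLinearGroup.scalar (Fin n) z ∈
      Subgroup.center (Matrix.GeneralLinearGroup (Fin n) ℂ) := by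
    rw [Matrix.GeneralLinearGroup.center_eq_range_scalar]
    exact ⟨z, rfl⟩
  exact (Subgroup.mem_center_iff.mp hz g).symm

/-- The scalar does not depend on the chosen preimages. -/
theorem commutatorScalar_spec (σ τ : Matrix.ProjGenLinGroup (Fin n) ℂ)
    (hc : σ * τ = τ * σ) (s t : Matrix.GeneralLinearGroup (Fin n) ℂ)
    (hs : Matrix.ProjGenLinGroup.mk s = σ) (ht : Matrix.ProjGenLinGroup.mk t = τ) :
    s * t * s⁻¹ * t⁻¹ = Matrix.GeneralLinearGroup.scalar (Fin n) (commutatorScalar σ τ hc) := by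
  have key := (exists_commutator_eq_scalar (chosenLift σ) (chosenLift τ)
    (by simpa only [mk_chosenLift] using hc)).choose_spec
  rw [commutatorScalar, ← key]
  obtain ⟨a, ha⟩ := Matrix.ProjGenLinGroup.mk_eq_mk_iff.mp ((mk_chosenLift σ).trans hs.symm)
  obtain ⟨b, hb⟩ := Matrix.ProjGenLinGroup.mk_eq_mk_iff.mp ((mk_chosenLift τ).trans ht.symm)
  have hA := scalar_comm (n := n) a
  have hB := scalar_comm (n := n) b
  rw [← ha, ← hb]
  generalize Matrix.GeneralLinearGroup.scalar (Fin n) a = A at *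
  generalize Matrix.GeneralLinearGroup.scalar (Fin n) b = B at *
  generalize chosenLift σ = x
  generalize chosenLift τ = y
  rw [← hA x, ← hB y]
  calc A * x * (B * y) * (A * x)⁻¹ * (B * y)⁻¹
      = A * (x * B) * y * x⁻¹ * A⁻¹ * (y⁻¹ * B⁻¹) := by group
    _ = A * (B * x) * y * x⁻¹ * A⁻¹ * (y⁻¹ * B⁻¹) := by rw [hB x]
    _ = (A * (B * (x * y * x⁻¹))) * A⁻¹ * (y⁻¹ * B⁻¹) := by group
    _ = (B * (x * y * x⁻¹)) * A * A⁻¹ * (y⁻¹ * B⁻¹) := by rw [hA (B * (x * y * x⁻¹))]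
    _ = B * (x * y * x⁻¹ * y⁻¹) * B⁻¹ := by group
    _ = (x * y * x⁻¹ * y⁻¹) * B * B⁻¹ := by rw [hB]
    _ = x * y * x⁻¹ * y⁻¹ := by group

theorem FiniteMaximalDiagonalizable.mul_comm' (K : FiniteMaximalDiagonalizable n)
    (σ τ : K.1) : σ.1 * τ.1 = τ.1 * σ.1 :=
  K.2.1.prop.comm σ.1 σ.2 τ.1 τ.2

variable [NeZero n]

theorem commutatorScalar_eq (σ τ : Matrix.ProjGenLinGroup (Fin n) ℂ)
    (hc : σ * τ = τ * σ) (s t : Matrix.GeneralLinearGroup (Fin n) ℂ)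
    (hs : Matrix.ProjGenLinGroup.mk s = σ) (ht : Matrix.ProjGenLinGroup.mk t = τ) (l : ℂˣ)
    (hl : s * t * s⁻¹ * t⁻¹ = Matrix.GeneralLinearGroup.scalar (Fin n) l) :
    commutatorScalar σ τ hc = l :=
  scalar_injective ((commutatorScalar_spec σ τ hc s t hs ht).symm.trans hl)

theorem commutatorScalar_mul_left (σ σ' τ : Matrix.ProjGenLinGroup (Fin n) ℂ)
    (h : σ * τ = τ * σ) (h' : σ' * τ = τ * σ') (h'' : (σ * σ') * τ = τ * (σ * σ')) :
    commutatorScalar (σ * σ') τ h'' = commutatorScalar σ τ h * commutatorScalar σ' τ h' := by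
  have e := commutatorScalar_spec σ τ h _ _ (mk_chosenLift σ) (mk_chosenLift τ)
  have e' := commutatorScalar_spec σ' τ h' _ _ (mk_chosenLift σ') (mk_chosenLift τ)
  refine commutatorScalar_eq _ _ h'' (chosenLift σ * chosenLift σ') (chosenLift τ)
    (by simp [mk_chosenLift]) (mk_chosenLift τ) _ ?_
  rw [map_mul, ← e]
  have hc := scalar_comm (commutatorScalar σ' τ h') (chosenLift σ)
  rw [← e'] at hc
  generalize chosenLift σ = x at *
  generalize chosenLift σ' = x' at *
  generalize chosenLift τ = y at *
  have hc2 := scalar_comm (commutatorScalar σ' τ h') (x * y * x⁻¹ * y⁻¹)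
  rw [← e'] at hc2 ⊢
  rw [← hc2]
  calc x * x' * y * (x * x')⁻¹ * y⁻¹
      = (x * (x' * y * x'⁻¹ * y⁻¹)) * y * x⁻¹ * y⁻¹ := by group
    _ = ((x' * y * x'⁻¹ * y⁻¹) * x) * y * x⁻¹ * y⁻¹ := by rw [hc]
    _ = (x' * y * x'⁻¹ * y⁻¹) * (x * y * x⁻¹ * y⁻¹) := by group

theorem commutatorScalar_swap (σ τ : Matrix.ProjGenLinGroup (Fin n) ℂ)
    (h : σ * τ = τ * σ) (h' : τ * σ = σ * τ) :
    commutatorScalar σ τ h = (commutatorScalar τ σ h')⁻¹ := by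
  refine commutatorScalar_eq _ _ h _ _ (mk_chosenLift σ) (mk_chosenLift τ) _ ?_
  rw [map_inv, ← commutatorScalar_spec τ σ h' _ _ (mk_chosenLift τ) (mk_chosenLift σ)]
  group

theorem commutatorScalar_mul_right (σ τ τ' : Matrix.ProjGenLinGroup (Fin n) ℂ)
    (h : σ * τ = τ * σ) (h' : σ * τ' = τ' * σ) (h'' : σ * (τ * τ') = (τ * τ') * σ) :
    commutatorScalar σ (τ * τ') h'' = commutatorScalar σ τ h * commutatorScalar σ τ' h' := by
  rw [commutatorScalar_swap σ (τ * τ') h'' h''.symm, commutatorScalar_swap σ τ h h.symm,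
    commutatorScalar_swap σ τ' h' h'.symm,
    commutatorScalar_mul_left τ τ' σ h.symm h'.symm h''.symm, mul_inv]

theorem commutatorScalar_self (σ : Matrix.ProjGenLinGroup (Fin n) ℂ) (h : σ * σ = σ * σ) :
    commutatorScalar σ σ h = 1 :=
  commutatorScalar_eq _ _ h _ _ (mk_chosenLift σ) (mk_chosenLift σ) 1 (by simp)

/-- A finite maximal diagonalizable subgroup `K` of `PGL(n, ℂ)` with its commutator pairing
`(σ, τ) ↦ commutatorScalar σ τ`, as a symplectic abelian group. -/
noncomputable def FiniteMaximalDiagonalizable.toSymplectic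
    (K : FiniteMaximalDiagonalizable n) : SymplecticAbelianGroup.{0} where
  carrier := K.1
  commGroup :=
    { (inferInstance : Group K.1) with
      mul_comm := fun a b => Subtype.ext (K.mul_comm' a b) }
  pairing := MonoidHom.mk' (fun σ => MonoidHom.mk'
      (fun τ => commutatorScalar σ.1 τ.1 (K.mul_comm' σ τ))
      (fun τ τ' => commutatorScalar_mul_right σ.1 τ.1 τ'.1 (K.mul_comm' σ τ) (K.mul_comm' σ τ')
        (K.mul_comm' σ (τ * τ'))))
    (fun σ σ' => MonoidHom.ext fun τ => commutatorScalar_mul_left σ.1 σ'.1 τ.1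
      (K.mul_comm' σ τ) (K.mul_comm' σ' τ) (K.mul_comm' (σ * σ') τ))
  pairing_self := fun σ => commutatorScalar_self σ.1 rfl

end CommutatorPairing

/-! The result is a finite Stone–von Neumann theorem. Lifts of the elements of K multiply up to
scalars and commute up to the pairing: they form a Weyl family. If such a family has scalar
commutant and nonsingular pairing, it spans M(n, ℂ) (`IsWeylFamily.expansion`, Schur's lemma by
averaging plus orthogonality of characters), and taking traces gives group order n²
(`IsWeylFamily.card_eq`).

For K itself, maximality forces the scalar commutant: a nontrivial idempotent e commuting with the
lifts would yield classes of e + t(1 - e), with t a root of unity, that centralize K and have finite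
order, hence lie in K, yet have order too large for K (`idempotent_eq_zero_or_one`). An element of
the radical of the pairing then has a scalar lift, so the pairing is nonsingular.

Injectivity: two Weyl families s, t with the same pairing give commuting operators X ↦ t(a) X
s(a)⁻¹; a common eigenvector is an intertwiner up to scalars, invertible because s spans
(`IsWeylFamily.exists_conj`).

Surjectivity: the pairing of H is the antisymmetrization of a bimultiplicative β
(`exists_antisymmetrization_eq`). The regular representation twisted by β, cut down to successive
eigenspaces of its commutant, is a Weyl family with scalar commutant; counting forces its dimension
to be n, and its image is maximal (`IsWeylFamily.maximal_range`). -/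

open Matrix

/-! ### Lifts from PGL and Weyl families -/

/-- Conjugation by an invertible matrix depends only on its class in `PGL`. -/
theorem conj_eq_of_mk_eq {n : ℕ} {g h : GL (Fin n) ℂ}
    (hgh : ProjGenLinGroup.mk g = ProjGenLinGroup.mk h) (X : Matrix (Fin n) (Fin n) ℂ) :
    g.1 * X * (g⁻¹).1 = h.1 * X * (h⁻¹).1 := by
  obtain ⟨u, rfl⟩ := ProjGenLinGroup.mk_eq_mk_iff.mp hgh
  rw [_root_.mul_inv_rev, Units.val_mul, Units.val_mul, ← map_inv, GeneralLinearGroup.coe_scalar,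
    GeneralLinearGroup.coe_scalar]
  simp [← Matrix.smul_one_eq_diagonal, Matrix.scalar_apply, smul_smul]

theorem mk_eq_mk_of_val_eq_smul {n : ℕ} {g h : GL (Fin n) ℂ} {c : ℂ} (hc : c ≠ 0)
    (hgh : g.1 = c • h.1) : ProjGenLinGroup.mk g = ProjGenLinGroup.mk h := by
  symm
  rw [ProjGenLinGroup.mk_eq_mk_iff]
  refine ⟨Units.mk0 c hc, Units.ext ?_⟩
  rw [Units.val_mul, GeneralLinearGroup.coe_scalar, hgh]
  simp [← Matrix.smul_one_eq_diagonal, Matrix.scalar_apply]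

theorem val_eq_smul_of_mk_eq {n : ℕ} {g h : GL (Fin n) ℂ}
    (hgh : ProjGenLinGroup.mk g = ProjGenLinGroup.mk h) : ∃ c : ℂˣ, g.1 = (c : ℂ) • h.1 := by
  obtain ⟨u, hu⟩ := ProjGenLinGroup.mk_eq_mk_iff.mp hgh.symm
  refine ⟨u, ?_⟩
  rw [← hu, Units.val_mul, GeneralLinearGroup.coe_scalar]
  simp [← Matrix.smul_one_eq_diagonal, Matrix.scalar_apply]

/-- Invertible matrices indexed by an abelian group, multiplicative up to scalars, with
commutators given by the pairing `ω`. -/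
structure IsWeylFamily {n : ℕ} {H : Type*} [CommGroup H] (s : H → GL (Fin n) ℂ)
    (ω : H →* H →* ℂˣ) : Prop where
  mk_mul : ∀ a b, ProjGenLinGroup.mk (s (a * b)) =
    ProjGenLinGroup.mk (s a) * ProjGenLinGroup.mk (s b)
  comm : ∀ a b, (s a).1 * (s b).1 = (ω a b : ℂ) • ((s b).1 * (s a).1)

/-- Only scalar matrices commute with the whole family. -/
def HasScalarCommutant {n : ℕ} {H : Type*} (s : H → GL (Fin n) ℂ) : Prop :=
  ∀ X : Matrix (Fin n) (Fin n) ℂ, (∀ a, (s a).1 * X = X * (s a).1) → ∃ c : ℂ, X = c • 1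

namespace IsWeylFamily

variable {n : ℕ} {H : Type*} [CommGroup H] {s : H → GL (Fin n) ℂ} {ω : H →* H →* ℂˣ}

theorem mk_one (hs : IsWeylFamily s ω) : ProjGenLinGroup.mk (s 1) = 1 := by
  simpa using hs.mk_mul 1 1

/-- The map to `PGL` underlying a Weyl family. -/
def toHom (hs : IsWeylFamily s ω) : H →* ProjGenLinGroup (Fin n) ℂ :=
  MonoidHom.mk' (fun a => ProjGenLinGroup.mk (s a)) hs.mk_mul

theorem conj_mul (hs : IsWeylFamily s ω) (a b : H) (X : Matrix (Fin n) (Fin n) ℂ) :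
    (s (a * b)).1 * X * ((s (a * b))⁻¹).1 =
      (s a).1 * ((s b).1 * X * ((s b)⁻¹).1) * ((s a)⁻¹).1 := by
  rw [conj_eq_of_mk_eq (h := s a * s b) (by rw [hs.mk_mul, map_mul]), _root_.mul_inv_rev,
    Units.val_mul, Units.val_mul]
  simp only [mul_assoc]

theorem conj_apply (hs : IsWeylFamily s ω) (a b : H) :
    (s a).1 * (s b).1 * ((s a)⁻¹).1 = (ω a b : ℂ) • (s b).1 := by
  rw [hs.comm, Matrix.smul_mul, mul_assoc, Units.mul_inv, mul_one]

theorem conj_inv (hs : IsWeylFamily s ω) (a b : H) :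
    (s a).1 * ((s b)⁻¹).1 * ((s a)⁻¹).1 = ((ω a b)⁻¹ : ℂˣ).1 • ((s b)⁻¹).1 := by
  have h : s a * (s b)⁻¹ * (s a)⁻¹ = (s a * s b * (s a)⁻¹)⁻¹ := by group
  have h2 : s a * s b * (s a)⁻¹ = GeneralLinearGroup.scalar (Fin n) (ω a b) * s b := by
    apply Units.ext
    rw [Units.val_mul, Units.val_mul, hs.conj_apply, Units.val_mul, GeneralLinearGroup.coe_scalar]
    simp [← Matrix.smul_one_eq_diagonal, Matrix.scalar_apply]
  rw [← Units.val_mul, ← Units.val_mul, h, h2, _root_.mul_inv_rev, ← map_inv, Units.val_mul,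
    GeneralLinearGroup.coe_scalar]
  simp [← Matrix.smul_one_eq_diagonal, Matrix.scalar_apply]

theorem inv_conj_inv (hs : IsWeylFamily s ω) (hself : ∀ a b, ω a b = (ω b a)⁻¹) (a b : H) :
    ((s b)⁻¹).1 * ((s a)⁻¹).1 * (s b).1 = ((ω a b)⁻¹ : ℂˣ).1 • ((s a)⁻¹).1 := by
  have h := hs.conj_inv b a
  have h2 : (s b).1 * (((s b)⁻¹).1 * ((s a)⁻¹).1 * (s b).1) * ((s b)⁻¹).1 = ((s a)⁻¹).1 := by
    simp [← mul_assoc]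
  have h3 : ((s a)⁻¹).1 = ((s b)⁻¹).1 * ((s b).1 * ((s a)⁻¹).1 * ((s b)⁻¹).1) * (s b).1 := by
    simp [← mul_assoc]
  conv_rhs => rw [h3, h]
  rw [Matrix.mul_smul, Matrix.smul_mul, smul_smul, hself a b]
  simp

/-! ### Averaging, orthogonality and the order of the group -/

section twirl

variable [Fintype H]

/-- The sum of the conjugates of `X` under a family of invertible matrices. -/
def twirl (s : H → GL (Fin n) ℂ) (X : Matrix (Fin n) (Fin n) ℂ) : Matrix (Fin n) (Fin n) ℂ :=
  ∑ a, (s a).1 * X * ((s a)⁻¹).1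

/-- Conjugation by `s b` permutes the summands, since conjugation depends only on the class in PGL.
-/
theorem mul_twirl (hs : IsWeylFamily s ω) (X : Matrix (Fin n) (Fin n) ℂ) (b : H) :
    (s b).1 * twirl s X = twirl s X * (s b).1 := by
  have h : (s b).1 * twirl s X * ((s b)⁻¹).1 = twirl s X := by
    rw [twirl, Finset.mul_sum, Finset.sum_mul]
    simp_rw [← hs.conj_mul]
    exact Fintype.sum_equiv (Equiv.mulLeft b) _ _ fun a => rfl
  conv_rhs => rw [← h]
  simp [mul_assoc]

theorem trace_twirl {ι : Type*} [Fintype ι] (s : ι → GL (Fin n) ℂ)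
    (X : Matrix (Fin n) (Fin n) ℂ) : (twirl s X).trace = Fintype.card ι * X.trace := by
  have h (a : ι) : ((s a).1 * X * ((s a)⁻¹).1).trace = X.trace := by
    rw [Matrix.trace_mul_comm, ← mul_assoc, ← Units.val_mul]
    simp
  simp_rw [twirl, Matrix.trace_sum, h]
  simp

/-- Schur's lemma: the average lies in the commutant, and its trace identifies the scalar. -/
theorem twirl_eq [NeZero n] (hs : IsWeylFamily s ω) (hc : HasScalarCommutant s)
    (X : Matrix (Fin n) (Fin n) ℂ) :
    twirl s X = (Fintype.card H * (X.trace / n)) • (1 : Matrix (Fin n) (Fin n) ℂ) := by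
  obtain ⟨c, h⟩ := hc _ (hs.mul_twirl X)
  have ht := trace_twirl s X
  rw [h, Matrix.trace_smul, Matrix.trace_one, smul_eq_mul, Fintype.card_fin] at ht
  have hn : (n : ℂ) ≠ 0 := NeZero.ne _
  rw [h]
  congr 1
  field_simp
  exact ht

/-- Orthogonality: b ↦ ω(a, b)⁻¹ is a character of H, trivial only for a = 1 by nonsingularity. -/
theorem sum_pairing_inv (hns : ∀ a, (∀ b, ω a b = 1) → a = 1) [DecidableEq H] (a : H) :
    ∑ b, ((ω a b)⁻¹ : ℂˣ).1 = if a = 1 then (Fintype.card H : ℂ) else 0 := by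
  classical
  have h := sum_hom_units ((Units.coeHom ℂ).comp (ω a)⁻¹)
  have e : ((Units.coeHom ℂ).comp (ω a)⁻¹ = 1) ↔ a = 1 := by
    constructor
    · intro h
      refine hns a fun b => ?_
      have := DFunLike.congr_fun h b
      simpa using this
    · rintro rfl
      ext
      simp
  simpa [e, apply_ite] using h

/-- A Weyl family with scalar commutant and nonsingular pairing spans the matrix algebra. -/
theorem expansion [NeZero n] (hs : IsWeylFamily s ω) (hc : HasScalarCommutant s)
    (hself : ∀ a b, ω a b = (ω b a)⁻¹) (hns : ∀ a, (∀ b, ω a b = 1) → a = 1)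
    (X : Matrix (Fin n) (Fin n) ℂ) :
    X = ∑ b, ((X * ((s b)⁻¹).1).trace / n) • (s b).1 := by
  classical
  -- The same sum is evaluated twice: here each twirl is a scalar; in `h3` the sum over b leaves
  -- only the term a = 1.
  have h1 : ∑ b, twirl s (X * ((s b)⁻¹).1) * (s b).1 =
      (Fintype.card H : ℂ) • ∑ b, ((X * ((s b)⁻¹).1).trace / n) • (s b).1 := by
    simp_rw [hs.twirl_eq hc, Matrix.smul_mul, one_mul, mul_smul, Finset.smul_sum]
  have h2 (a b : H) : (s a).1 * (X * ((s b)⁻¹).1) * ((s a)⁻¹).1 * (s b).1 =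
      ((ω a b)⁻¹ : ℂˣ).1 • ((s a).1 * X * ((s a)⁻¹).1) := by
    rw [← Matrix.mul_smul, ← hs.inv_conj_inv hself]
    simp only [mul_assoc]
  have h3 : ∑ b, twirl s (X * ((s b)⁻¹).1) * (s b).1 = (Fintype.card H : ℂ) • X := by
    simp_rw [twirl, Finset.sum_mul, h2]
    rw [Finset.sum_comm]
    simp_rw [← Finset.sum_smul, sum_pairing_inv hns]
    simp only [ite_smul, zero_smul, Finset.sum_ite_eq', Finset.mem_univ, if_true]
    rw [conj_eq_of_mk_eq (h := 1) (by rw [hs.mk_one, map_one])]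
    simp
  have hH : (Fintype.card H : ℂ) ≠ 0 := Nat.cast_ne_zero.mpr Fintype.card_ne_zero
  exact smul_right_injective _ hH (h3.symm.trans h1)

/-- The expansion writes the identity operator of M(n, ℂ) as a sum of rank-one operators indexed by
H. Its trace is n², and each summand has trace tr(s(b)⁻¹ s(b)) / n = 1. -/
theorem card_eq [NeZero n] (hs : IsWeylFamily s ω) (hc : HasScalarCommutant s)
    (hself : ∀ a b, ω a b = (ω b a)⁻¹) (hns : ∀ a, (∀ b, ω a b = 1) → a = 1) :
    Fintype.card H = n ^ 2 := by
  have h (i j : Fin n) : (1 : ℂ) = ∑ b, ((s b)⁻¹).1 j i / n * (s b).1 i j := by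
    have := congrFun (congrFun (hs.expansion hc hself hns (Matrix.single i j 1)) i) j
    rw [Matrix.single_apply_same, Matrix.sum_apply] at this
    simpa [Matrix.trace_single_mul] using this
  have hn : (n : ℂ) ≠ 0 := NeZero.ne _
  have h2 (b : H) : ∑ j, ∑ i, ((s b)⁻¹).1 j i / n * (s b).1 i j = 1 := by
    have e : (((s b)⁻¹).1 * (s b).1).trace = n := by
      rw [← Units.val_mul]
      simp
    have e2 : ∑ j, ∑ i, ((s b)⁻¹).1 j i / n * (s b).1 i j =
        (((s b)⁻¹).1 * (s b).1).trace / n := by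
      simp only [Matrix.trace, Matrix.diag_apply, Matrix.mul_apply, Finset.sum_div,
        div_mul_eq_mul_div]
    rw [e2, e, div_self hn]
  have h3 : ∑ j : Fin n, ∑ i : Fin n, (1 : ℂ) = Fintype.card H := by
    rw [Finset.sum_congr rfl fun j _ => Finset.sum_congr rfl fun i _ => h i j,
      Finset.sum_congr rfl fun j _ => Finset.sum_comm, Finset.sum_comm,
      Finset.sum_congr rfl fun b _ => h2 b]
    simp
  have h4 : ((n ^ 2 : ℕ) : ℂ) = Fintype.card H := by
    rw [← h3]
    simp [pow_two]
  exact_mod_cast h4.symm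

end twirl

end IsWeylFamily

/-! ### Common eigenvectors -/

/-- Commuting endomorphisms of a nonzero finite-dimensional complex vector space have a common
eigenvector. -/
theorem exists_common_eigenvector {ι : Type*} (d : ℕ) :
    ∀ {V : Type*} [AddCommGroup V] [Module ℂ V] [FiniteDimensional ℂ V] [Nontrivial V]
      (_ : Module.finrank ℂ V = d) (Q : ι → Module.End ℂ V) (_ : ∀ i j, Q i * Q j = Q j * Q i),
      ∃ v : V, v ≠ 0 ∧ ∀ i, ∃ μ : ℂ, Q i v = μ • v := by
  induction d using Nat.strong_induction_on with
  | _ d ih =>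
  intro V _ _ _ _ hd Q hQ
  by_cases hsc : ∀ i, ∃ μ : ℂ, ∀ v, Q i v = μ • v
  · obtain ⟨v, hv⟩ := exists_ne (0 : V)
    exact ⟨v, hv, fun i => (hsc i).imp fun μ h => h v⟩
  push Not at hsc
  obtain ⟨i, hi⟩ := hsc
  -- An eigenspace of the non-scalar `Q i` is nonzero, proper and stable under all `Q j`.
  obtain ⟨μ, hμ⟩ := Module.End.exists_eigenvalue (Q i)
  obtain ⟨v₀, hv₀⟩ := hi μ
  set W := Module.End.eigenspace (Q i) μ with hW
  have hWtop : W ≠ ⊤ := fun h =>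
    hv₀ (Module.End.mem_eigenspace_iff.mp (show v₀ ∈ W from h ▸ Submodule.mem_top))
  have hinv (j : ι) : ∀ w ∈ W, Q j w ∈ W := by
    intro w hw
    rw [hW, Module.End.mem_eigenspace_iff] at hw ⊢
    rw [← Module.End.mul_apply, hQ i j, Module.End.mul_apply, hw, map_smul]
  have : Nontrivial W := Submodule.nontrivial_iff_ne_bot.mpr hμ
  obtain ⟨w, hw, hw'⟩ := ih _ (hd ▸ Submodule.finrank_lt hWtop) (V := W) rfl
    (fun j => (Q j).restrict (hinv j)) (fun j k => by
      ext w
      exact congrArg (fun f : Module.End ℂ V => f w) (hQ j k))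
  refine ⟨w, fun h => hw (Subtype.ext h), fun j => ?_⟩
  obtain ⟨ν, hν⟩ := hw' j
  exact ⟨ν, congrArg Subtype.val hν⟩

/-! ### Consequences of maximality for torsion elements -/

theorem adjointAction_pow {n : ℕ} (g : GL (Fin n) ℂ) (k : ℕ) :
    adjointAction g ^ k = adjointAction (g ^ k) := by
  induction k with
  | zero =>
    ext1 X
    simp [adjointAction_apply]
  | succ k ih =>
    refine LinearMap.ext fun X => ?_
    rw [pow_succ', Module.End.mul_apply, ih, adjointAction_apply, adjointAction_apply,
      adjointAction_apply, pow_succ', _root_.mul_inv_rev, Units.val_mul, Units.val_mul]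
    simp only [mul_assoc]

/-- If σ has order dividing m, the adjoint action is killed by X ^ m - 1, which is separable over ℂ.
-/
theorem isSemisimpleElement_of_isOfFinOrder {n : ℕ} {σ : ProjGenLinGroup (Fin n) ℂ}
    (h : IsOfFinOrder σ) : IsSemisimpleElement σ := by
  rintro g rfl
  obtain ⟨m, hm, h⟩ := isOfFinOrder_iff_pow_eq_one.mp h
  have h1 : adjointAction g ^ m = 1 := by
    rw [adjointAction_pow]
    refine LinearMap.ext fun X => ?_
    rw [adjointAction_apply, conj_eq_of_mk_eq (h := 1) (by rw [map_pow, h, map_one])]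
    simp
  refine Module.End.isSemisimple_of_squarefree_aeval_eq_zero
    (p := (Polynomial.X ^ m - 1 : Polynomial ℂ)) ?_ (by simp [h1])
  exact (Polynomial.X_pow_sub_one_separable_iff.mpr (by exact_mod_cast hm.ne')).squarefree

namespace FiniteMaximalDiagonalizable

variable {n : ℕ} (K : FiniteMaximalDiagonalizable n)

/-- K and x generate an abelian group of torsion elements, which is therefore diagonalizable;
maximality of K absorbs it. -/
theorem mem_of_isOfFinOrder {x : ProjGenLinGroup (Fin n) ℂ} (hx : IsOfFinOrder x)
    (hc : ∀ σ ∈ K.1, x * σ = σ * x) : x ∈ K.1 := by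
  have := K.2.2
  have hcomm : ∀ y ∈ insert x (K.1 : Set (ProjGenLinGroup (Fin n) ℂ)),
      ∀ z ∈ insert x (K.1 : Set (ProjGenLinGroup (Fin n) ℂ)), y * z = z * y := by
    rintro y (rfl | hy) z (rfl | hz)
    · rfl
    · exact hc z hz
    · exact (hc y hy).symm
    · exact K.2.1.prop.comm y hy z hz
  have hmc := Subgroup.isMulCommutative_closure hcomm
  set L := Subgroup.closure (insert x (K.1 : Set (ProjGenLinGroup (Fin n) ℂ))) with hL
  have hLc : ∀ y ∈ L, ∀ z ∈ L, y * z = z * y := fun y hy z hz =>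
    congrArg Subtype.val (hmc.is_comm.comm ⟨y, hy⟩ ⟨z, hz⟩)
  have hfin : ∀ y ∈ L, IsOfFinOrder y := by
    intro y hy
    induction hy using Subgroup.closure_induction with
    | mem y hy =>
      rcases hy with rfl | hy
      · exact hx
      · exact K.1.subtype.isOfFinOrder (isOfFinOrder_of_finite (⟨y, hy⟩ : K.1))
    | one => exact IsOfFinOrder.one
    | mul y z hy hz ihy ihz => exact Commute.isOfFinOrder_mul (hLc y hy z hz) ihy ihz
    | inv y hy ih => exact ih.inv
  have hLd : IsDiagonalizableSubgroup L :=
    ⟨hLc, fun y hy => isSemisimpleElement_of_isOfFinOrder (hfin y hy)⟩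
  exact K.2.1.le_of_ge hLd (fun y hy => Subgroup.subset_closure (Or.inr hy))
    (Subgroup.subset_closure (Or.inl rfl))

variable [NeZero n]

/-- The inclusion of `K` into `PGL`. -/
noncomputable def incl : K.toSymplectic.carrier →* ProjGenLinGroup (Fin n) ℂ :=
  MonoidHom.mk' (fun a => Subtype.val (p := (· ∈ K.1)) a) fun _ _ => rfl

theorem incl_injective : Function.Injective K.incl :=
  fun _ _ h => Subtype.ext h

theorem incl_mem (a : K.toSymplectic.carrier) : K.incl a ∈ K.1 :=
  Subtype.property (p := (· ∈ K.1)) a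

theorem exists_incl_eq {σ : ProjGenLinGroup (Fin n) ℂ} (hσ : σ ∈ K.1) : ∃ a, K.incl a = σ :=
  ⟨⟨σ, hσ⟩, rfl⟩

instance : Finite K.toSymplectic.carrier :=
  K.2.2

/-- Chosen preimages of the elements of `K`. -/
noncomputable def lift (a : K.toSymplectic.carrier) : GL (Fin n) ℂ :=
  chosenLift (K.incl a)

theorem mk_lift (a : K.toSymplectic.carrier) : ProjGenLinGroup.mk (K.lift a) = K.incl a :=
  mk_chosenLift _

theorem idempotent_eq_zero_or_one {e : Matrix (Fin n) (Fin n) ℂ} (he : e * e = e)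
    (hc : ∀ σ, (K.lift σ).1 * e = e * (K.lift σ).1) : e = 0 ∨ e = 1 := by
  -- The order |K| + 1 is chosen so that t ^ |K| ≠ 1, whereas every element of K is killed by |K|.
  set N := Nat.card K.toSymplectic.carrier + 1 with hN
  have ht := Complex.isPrimitiveRoot_exp N (by omega)
  set t := Complex.exp (2 * Real.pi * Complex.I / N)
  have ht0 : t ≠ 0 := ht.ne_zero (by omega)
  have hmul (a b : ℂ) : (e + a • (1 - e)) * (e + b • (1 - e)) = e + (a * b) • (1 - e) := by
    simp only [mul_add, add_mul, Matrix.mul_smul, Matrix.smul_mul, mul_sub, sub_mul, he, mul_one,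
      one_mul, sub_self, smul_zero, add_zero, zero_add, sub_zero, smul_smul]
    rw [mul_comm b a]
  let T : GL (Fin n) ℂ := ⟨e + t • (1 - e), e + t⁻¹ • (1 - e), by
    rw [hmul, mul_inv_cancel₀ ht0]; simp, by rw [hmul, inv_mul_cancel₀ ht0]; simp⟩
  have hpow (k : ℕ) : (T ^ k).1 = e + t ^ k • (1 - e) := by
    induction k with
    | zero => simp
    | succ k ih => rw [pow_succ, Units.val_mul, ih, pow_succ, ← hmul]
  have hTN : T ^ N = 1 := Units.ext (by rw [hpow, ht.pow_eq_one]; simp)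
  have hTK : ProjGenLinGroup.mk T ∈ K.1 := by
    refine K.mem_of_isOfFinOrder
      (isOfFinOrder_iff_pow_eq_one.mpr ⟨N, by omega, by rw [← map_pow, hTN, map_one]⟩) ?_
    intro σ hσ
    obtain ⟨a, rfl⟩ := K.exists_incl_eq hσ
    rw [← K.mk_lift a, ← map_mul, ← map_mul]
    congr 1
    apply Units.ext
    rw [Units.val_mul, Units.val_mul]
    simp only [T, mul_add, add_mul, Matrix.mul_smul, Matrix.smul_mul, mul_sub, sub_mul, hc,
      mul_one, one_mul]
  have h1 : ProjGenLinGroup.mk (T ^ Nat.card K.toSymplectic.carrier) = ProjGenLinGroup.mk 1 := by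
    rw [map_pow, map_one]
    obtain ⟨a, ha⟩ := K.exists_incl_eq hTK
    rw [← ha, ← map_pow, pow_card_eq_one', map_one]
  obtain ⟨c, hc⟩ := val_eq_smul_of_mk_eq h1
  rw [hpow, Units.val_one] at hc
  by_contra! hne
  -- T ^ |K| is the scalar c; on the range of e ≠ 0 it acts as 1, on that of 1 - e ≠ 0 as t ^ |K|.
  have hc1 : (c : ℂ) = 1 := by
    have := congrArg (e * ·) hc
    simp only [mul_add, Matrix.mul_smul, mul_sub, he, mul_one, sub_self, smul_zero,
      add_zero] at this
    exact (smul_left_injective ℂ hne.1 ((one_smul ℂ e).trans this)).symm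
  have h2 : t ^ Nat.card K.toSymplectic.carrier = 1 := by
    rw [hc1, one_smul, ← sub_eq_zero] at hc
    have h3 : (t ^ Nat.card K.toSymplectic.carrier - 1) • (1 - e) = 0 := by
      rw [← hc, sub_smul, one_smul]
      abel
    rcases smul_eq_zero.mp h3 with h | h
    · exact sub_eq_zero.mp h
    · exact absurd (sub_eq_zero.mp h).symm hne.2
  have h4 := Nat.le_of_dvd (Nat.card_pos (α := K.toSymplectic.carrier)) (ht.dvd_of_pow_eq_one _ h2)
  omega

theorem isWeylFamily : IsWeylFamily K.lift K.toSymplectic.pairing where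
  mk_mul a b := by
    rw [K.mk_lift, K.mk_lift, K.mk_lift, map_mul]
  comm a b := by
    have h : K.lift a * K.lift b * (K.lift a)⁻¹ * (K.lift b)⁻¹ =
        GeneralLinearGroup.scalar (Fin n) (K.toSymplectic.pairing a b) :=
      commutatorScalar_spec (K.incl a) (K.incl b) (K.mul_comm' a b) _ _ (K.mk_lift a) (K.mk_lift b)
    have h2 : K.lift a * K.lift b =
        GeneralLinearGroup.scalar (Fin n) (K.toSymplectic.pairing a b) *
          (K.lift b * K.lift a) := by
      rw [← h]
      group
    rw [← Units.val_mul, h2, Units.val_mul, Units.val_mul, GeneralLinearGroup.coe_scalar]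
    simp [Matrix.scalar_apply, ← Matrix.smul_one_eq_diagonal]

end FiniteMaximalDiagonalizable

/-! ### Scalar commutant, nonsingularity and order of K -/

/-- Every square matrix has a projection onto its kernel. -/
theorem exists_projection_ker {n : ℕ} (Y : Matrix (Fin n) (Fin n) ℂ) :
    ∃ e : Matrix (Fin n) (Fin n) ℂ, Y * e = 0 ∧ ∀ Z, Y * Z = 0 → e * Z = Z := by
  obtain ⟨g, hg⟩ := LinearMap.exists_leftInverse_of_injective
    (LinearMap.ker (Matrix.toLin' Y)).subtype (Submodule.ker_subtype _)
  refine ⟨LinearMap.toMatrix' ((LinearMap.ker (Matrix.toLin' Y)).subtype ∘ₗ g), ?_, ?_⟩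
  · apply (Matrix.toLin' (R := ℂ)).injective
    rw [Matrix.toLin'_mul, Matrix.toLin'_toMatrix']
    refine LinearMap.ext fun v => ?_
    simp
  · intro Z hZ
    apply (Matrix.toLin' (R := ℂ)).injective
    rw [Matrix.toLin'_mul, Matrix.toLin'_toMatrix']
    refine LinearMap.ext fun v => ?_
    have hv : Matrix.toLin' Z v ∈ LinearMap.ker (Matrix.toLin' Y) := by
      rw [LinearMap.mem_ker, ← LinearMap.comp_apply, ← Matrix.toLin'_mul, hZ]
      simp
    have := LinearMap.congr_fun hg ⟨_, hv⟩
    exact congrArg Subtype.val this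

/-- Over `ℂ`, every square matrix `X` has an eigenvalue `μ`. -/
theorem exists_singular_sub_smul {n : ℕ} [NeZero n] (X : Matrix (Fin n) (Fin n) ℂ) :
    ∃ μ : ℂ, ∃ Z : Matrix (Fin n) (Fin n) ℂ, Z ≠ 0 ∧ (X - μ • 1) * Z = 0 := by
  obtain ⟨μ, hμ⟩ := Module.End.exists_eigenvalue (Matrix.toLin' X)
  obtain ⟨v, hv⟩ := hμ.exists_hasEigenvector
  have hv1 := hv.apply_eq_smul
  rw [Matrix.toLin'_apply] at hv1
  -- All columns of Z equal the eigenvector v.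
  refine ⟨μ, Matrix.of fun i _ => v i, fun h => hv.2 ?_, ?_⟩
  · ext i
    exact congrFun (congrFun h i) 0
  · ext i j
    have h2 := congrFun hv1 i
    have h3 : ((X - μ • 1) *ᵥ v) i = 0 := by
      rw [Matrix.sub_mulVec, Matrix.smul_mulVec, Matrix.one_mulVec, Pi.sub_apply, h2, sub_self]
    exact h3

/-- Maschke's argument: averaging a projection onto an eigenspace of X over K gives an idempotent in
the commutant with the same range. It is nonzero, hence 1, so X is the scalar μ. -/
theorem FiniteMaximalDiagonalizable.hasScalarCommutant {n : ℕ} [NeZero n]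
    (K : FiniteMaximalDiagonalizable n) :
    HasScalarCommutant K.lift := by
  have := Fintype.ofFinite K.toSymplectic.carrier
  intro X hX
  obtain ⟨μ, Z, hZ0, hZ⟩ := exists_singular_sub_smul X
  refine ⟨μ, ?_⟩
  set Y := X - μ • (1 : Matrix (Fin n) (Fin n) ℂ) with hYdef
  have hY (a : K.toSymplectic.carrier) : (K.lift a).1 * Y = Y * (K.lift a).1 := by
    simp [hYdef, mul_sub, sub_mul, hX a]
  have hY' (a : K.toSymplectic.carrier) : ((K.lift a)⁻¹).1 * Y = Y * ((K.lift a)⁻¹).1 := by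
    have h := congrArg (fun M => ((K.lift a)⁻¹).1 * M * ((K.lift a)⁻¹).1) (hY a)
    simp only [← mul_assoc, Units.inv_mul, one_mul] at h
    rw [h, mul_assoc, mul_assoc, Units.mul_inv, mul_one]
  obtain ⟨e₀, he₀, he₀'⟩ := exists_projection_ker Y
  set N : ℂ := (Fintype.card K.toSymplectic.carrier : ℂ) with hN
  have hN0 : N ≠ 0 := Nat.cast_ne_zero.mpr Fintype.card_ne_zero
  set e := N⁻¹ • IsWeylFamily.twirl K.lift e₀ with he
  have hYe : Y * e = 0 := by
    rw [he, Matrix.mul_smul, IsWeylFamily.twirl, Finset.mul_sum, Finset.sum_eq_zero, smul_zero]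
    intro a _
    rw [← mul_assoc, ← mul_assoc, ← hY, mul_assoc _ Y, he₀, mul_zero, zero_mul]
  have heZ (W : Matrix (Fin n) (Fin n) ℂ) (hW : Y * W = 0) : e * W = W := by
    have (a : K.toSymplectic.carrier) : (K.lift a).1 * e₀ * ((K.lift a)⁻¹).1 * W = W := by
      rw [mul_assoc, mul_assoc, he₀', ← mul_assoc, Units.mul_inv, one_mul]
      rw [← mul_assoc, ← hY', mul_assoc, hW, mul_zero]
    rw [he, Matrix.smul_mul, IsWeylFamily.twirl, Finset.sum_mul,
      Finset.sum_congr rfl fun a _ => this a, Finset.sum_const, Finset.card_univ, ← Nat.cast_smul_eq_nsmul ℂ, smul_smul,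
      inv_mul_cancel₀ hN0, one_smul]
  rcases K.idempotent_eq_zero_or_one (heZ e hYe) (fun a => by
    rw [he, Matrix.mul_smul, Matrix.smul_mul]
    exact congrArg (N⁻¹ • ·) (K.isWeylFamily.mul_twirl e₀ a)) with h | h
  · exact absurd (by rw [← heZ Z hZ, h, zero_mul]) hZ0
  · rw [h, mul_one] at hYe
    exact sub_eq_zero.mp hYe

/-- The lift of an element of the radical commutes with all lifts, so it is scalar and trivial in
PGL. -/
theorem FiniteMaximalDiagonalizable.nonsingular {n : ℕ} [NeZero n]
    (K : FiniteMaximalDiagonalizable n) : K.toSymplectic.Nonsingular := by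
  intro a ha
  obtain ⟨c, hc⟩ := K.hasScalarCommutant (K.lift a).1 fun b => by
    rw [K.isWeylFamily.comm a b, ha, Units.val_one, one_smul]
  have hc0 : c ≠ 0 := by
    rintro rfl
    exact (K.lift a).ne_zero (by rw [hc, zero_smul])
  have := mk_eq_mk_of_val_eq_smul (h := 1) hc0 hc
  rw [K.mk_lift, map_one] at this
  exact K.incl_injective (this.trans K.incl.map_one.symm)

theorem FiniteMaximalDiagonalizable.card_eq {n : ℕ} [NeZero n]
    (K : FiniteMaximalDiagonalizable n) : Nat.card K.toSymplectic.carrier = n ^ 2 := by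
  have := Fintype.ofFinite K.toSymplectic.carrier
  rw [Nat.card_eq_fintype_card]
  exact K.isWeylFamily.card_eq K.hasScalarCommutant K.toSymplectic.pairing_antisymm K.nonsingular

/-! ### Uniqueness up to conjugation, and maximality of the image -/

theorem eq_scalar_mul_of_val {n : ℕ} {g h : GL (Fin n) ℂ} {c : ℂˣ} (hgh : g.1 = (c : ℂ) • h.1) :
    g = GeneralLinearGroup.scalar (Fin n) c * h := by
  apply Units.ext
  rw [hgh, Units.val_mul, GeneralLinearGroup.coe_scalar]
  simp [Matrix.scalar_apply, ← Matrix.smul_one_eq_diagonal]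

namespace IsWeylFamily

variable {n : ℕ} {H : Type*} [CommGroup H] {s t : H → GL (Fin n) ℂ} {ω : H →* H →* ℂˣ}

theorem commutator (hs : IsWeylFamily s ω) (a b : H) :
    s a * s b * (s a)⁻¹ * (s b)⁻¹ = GeneralLinearGroup.scalar (Fin n) (ω a b) := by
  have := eq_scalar_mul_of_val (g := s a * s b) (h := s b * s a) (hs.comm a b)
  rw [this]
  group

theorem toHom_injective [NeZero n] (hs : IsWeylFamily s ω)
    (hns : ∀ a, (∀ b, ω a b = 1) → a = 1) : Function.Injective hs.toHom := by
  rw [injective_iff_map_eq_one]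
  intro a ha
  refine hns a fun b => ?_
  have hz : s a ∈ Subgroup.center (GL (Fin n) ℂ) := ProjGenLinGroup.mk_eq_one.mp ha
  apply scalar_injective (n := n)
  rw [← hs.commutator, ← Subgroup.mem_center_iff.mp hz (s b), map_one]
  group

theorem conj (hs : IsWeylFamily s ω) (P : GL (Fin n) ℂ) :
    IsWeylFamily (fun a => P * s a * P⁻¹) ω where
  mk_mul a b := by
    simp only [map_mul, map_inv, hs.mk_mul]
    group
  comm a b := by
    have h := eq_scalar_mul_of_val (g := s a * s b) (h := s b * s a) (hs.comm a b)
    have h2 : P * s a * P⁻¹ * (P * s b * P⁻¹) =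
        GeneralLinearGroup.scalar (Fin n) (ω a b) * (P * s b * P⁻¹ * (P * s a * P⁻¹)) := by
      calc P * s a * P⁻¹ * (P * s b * P⁻¹) = P * (s a * s b) * P⁻¹ := by group
        _ = (P * GeneralLinearGroup.scalar (Fin n) (ω a b)) * (s b * s a) * P⁻¹ := by
          rw [h]
          group
        _ = _ := by
          rw [← scalar_comm]
          group
    rw [← Units.val_mul, ← Units.val_mul, h2, Units.val_mul, GeneralLinearGroup.coe_scalar]
    simp [Matrix.scalar_apply, ← Matrix.smul_one_eq_diagonal]

theorem inv_comm (hs : IsWeylFamily s ω) (a b : H) :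
    ((s b)⁻¹).1 * ((s a)⁻¹).1 = ((ω a b)⁻¹ : ℂˣ).1 • (((s a)⁻¹).1 * ((s b)⁻¹).1) := by
  rw [← Matrix.mul_smul, ← hs.conj_inv, mul_assoc, ← mul_assoc, Units.inv_mul, one_mul]

/-- Weyl families with the same nonsingular pairing and scalar commutant are conjugate up to
scalars. -/
theorem exists_conj [NeZero n] [Finite H] (hs : IsWeylFamily s ω) (ht : IsWeylFamily t ω)
    (hc : HasScalarCommutant s) (hself : ∀ a b, ω a b = (ω b a)⁻¹)
    (hns : ∀ a, (∀ b, ω a b = 1) → a = 1) :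
    ∃ P : GL (Fin n) ℂ, ∀ a, ProjGenLinGroup.mk (P * s a * P⁻¹) = ProjGenLinGroup.mk (t a) := by
  have := Fintype.ofFinite H
  let Q (a : H) : Module.End ℂ (Matrix (Fin n) (Fin n) ℂ) :=
    LinearMap.mulLeftRight ℂ ((t a).1, ((s a)⁻¹).1)
  have hQa (a : H) (X : Matrix (Fin n) (Fin n) ℂ) : Q a X = (t a).1 * X * ((s a)⁻¹).1 := by
    simp only [Q, LinearMap.mulLeftRight_apply]
  -- These operators commute because the scalars ω(a, b) from t and ω(a, b)⁻¹ from s⁻¹ cancel.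
  obtain ⟨P, hP0, hP⟩ := exists_common_eigenvector _ rfl Q fun a b => by
    refine LinearMap.ext fun X => ?_
    rw [Module.End.mul_apply, Module.End.mul_apply, hQa, hQa, hQa, hQa]
    calc (t a).1 * ((t b).1 * X * ((s b)⁻¹).1) * ((s a)⁻¹).1
        = ((t a).1 * (t b).1) * X * (((s b)⁻¹).1 * ((s a)⁻¹).1) := by simp only [mul_assoc]
      _ = ((t b).1 * (t a).1) * X * (((s a)⁻¹).1 * ((s b)⁻¹).1) := by
        rw [ht.comm, hs.inv_comm, Matrix.smul_mul, Matrix.smul_mul, Matrix.mul_smul, smul_smul,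
          Units.mul_inv, one_smul]
      _ = _ := by simp only [mul_assoc]
  choose μ hμ using hP
  have hμP (a : H) : (t a).1 * P = μ a • (P * (s a).1) := by
    rw [← Matrix.smul_mul, ← hμ, hQa, mul_assoc, Units.inv_mul, mul_one]
  have hμ0 (a : H) : μ a ≠ 0 := by
    intro h
    have h2 := hμP a
    rw [h, zero_smul] at h2
    apply hP0
    rw [← one_mul P, ← Units.inv_mul (t a), mul_assoc, h2, mul_zero]
  -- The kernel of P is stable under every `s a`, hence under all matrices since s spans; a nonzero
  -- kernel would make P = 0.
  have hdet : P.det ≠ 0 := by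
    intro hdet
    obtain ⟨v, hv0, hv⟩ := Matrix.exists_mulVec_eq_zero_iff.mpr hdet
    have h1 (a : H) : (P * (s a).1) *ᵥ v = 0 := by
      have h := congrArg (· *ᵥ v) (hμP a)
      simp only [Matrix.smul_mulVec, ← Matrix.mulVec_mulVec, hv, Matrix.mulVec_zero] at h
      rw [← Matrix.mulVec_mulVec]
      exact (smul_eq_zero.mp h.symm).resolve_left (hμ0 a)
    have h2 (X : Matrix (Fin n) (Fin n) ℂ) : (P * X) *ᵥ v = 0 := by
      rw [hs.expansion hc hself hns X, Finset.mul_sum, Matrix.sum_mulVec]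
      refine Finset.sum_eq_zero fun a _ => ?_
      rw [Matrix.mul_smul, Matrix.smul_mulVec, h1, smul_zero]
    obtain ⟨i, hi⟩ := Function.ne_iff.mp hv0
    apply hP0
    ext k j
    have h3 := congrFun (h2 (Matrix.single j i 1)) k
    rw [← Matrix.mulVec_mulVec, Matrix.single_mulVec] at h3
    have h4 : P k j = 0 ∨ v i = 0 := by
      simpa [Function.update_apply, Matrix.mulVec, dotProduct] using h3
    exact h4.resolve_right hi
  refine ⟨GeneralLinearGroup.mkOfDetNeZero P hdet, fun a => ?_⟩
  have h3 : t a * GeneralLinearGroup.mkOfDetNeZero P hdet =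
      GeneralLinearGroup.scalar (Fin n) (Units.mk0 (μ a) (hμ0 a)) *
        (GeneralLinearGroup.mkOfDetNeZero P hdet * s a) :=
    eq_scalar_mul_of_val (hμP a)
  have h4 := congrArg ProjGenLinGroup.mk h3
  rw [map_mul, map_mul _ (GeneralLinearGroup.scalar _ _), ProjGenLinGroup.mk_scalar, one_mul] at h4
  rw [map_mul, map_inv, ← h4]
  group

/-- The image in `PGL` of a Weyl family with scalar commutant and nonsingular pairing is maximal
diagonalizable. -/
theorem maximal_range [NeZero n] [Finite H] (hs : IsWeylFamily s ω)
    (hc : HasScalarCommutant s) (hself : ∀ a b, ω a b = (ω b a)⁻¹)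
    (hns : ∀ a, (∀ b, ω a b = 1) → a = 1) : Maximal IsDiagonalizableSubgroup hs.toHom.range := by
  have := Fintype.ofFinite H
  refine ⟨⟨?_, ?_⟩, fun L hL hle => ?_⟩
  · rintro _ ⟨a, rfl⟩ _ ⟨b, rfl⟩
    rw [← map_mul, ← map_mul, mul_comm]
  · rintro _ ⟨a, rfl⟩
    exact isSemisimpleElement_of_isOfFinOrder (hs.toHom.isOfFinOrder (isOfFinOrder_of_finite a))
  · intro x hx
    obtain ⟨g, rfl⟩ := ProjGenLinGroup.mk_surjective x
    -- Some coefficient of g in the expansion is nonzero; the claim is that g is a multiple of that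
    -- `s b`.
    obtain ⟨b, hb⟩ : ∃ b, (g.1 * ((s b)⁻¹).1).trace ≠ 0 := by
      by_contra! h
      apply g.ne_zero
      rw [hs.expansion hc hself hns g.1]
      simp_rw [h, zero_div, zero_smul, Finset.sum_const_zero]
    obtain ⟨c, hgc⟩ := hc (g.1 * ((s b)⁻¹).1) fun a => by
      obtain ⟨l, hl⟩ := exists_commutator_eq_scalar (s a) g
        (hL.comm _ (hle ⟨a, rfl⟩) _ hx)
      have h1 : s a * g = GeneralLinearGroup.scalar (Fin n) l * (g * s a) := by
        rw [← hl]
        group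
      have h2 : (s a).1 * g.1 = (l : ℂ) • (g.1 * (s a).1) := by
        rw [← Units.val_mul, h1, Units.val_mul, GeneralLinearGroup.coe_scalar]
        simp [Matrix.scalar_apply, ← Matrix.smul_one_eq_diagonal]
      have h3 : (s a).1 * (g.1 * ((s b)⁻¹).1) =
          ((l : ℂ) * ((ω a b)⁻¹ : ℂˣ).1) • ((g.1 * ((s b)⁻¹).1) * (s a).1) := by
        have e : (s a).1 * ((s b)⁻¹).1 = ((ω a b)⁻¹ : ℂˣ).1 • (((s b)⁻¹).1 * (s a).1) := by
          rw [← Matrix.smul_mul, ← hs.conj_inv, mul_assoc _ _ (s a).1, Units.inv_mul, mul_one]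
        rw [← mul_assoc, h2, Matrix.smul_mul, mul_assoc, e, Matrix.mul_smul, smul_smul, mul_assoc]
      -- Conjugation by `s a` multiplies g s(b)⁻¹ by a scalar and preserves its nonzero trace, so
      -- the scalar is 1.
      have h4 := congrArg (fun M => (M * ((s a)⁻¹).1).trace) h3
      simp only [Matrix.smul_mul, Matrix.trace_smul] at h4
      rw [mul_assoc _ (s a).1, Units.mul_inv, mul_one, Matrix.trace_mul_comm, ← mul_assoc,
        Units.inv_mul, one_mul, smul_eq_mul] at h4
      rw [h3, mul_right_cancel₀ hb (h4.symm.trans (one_mul _).symm), one_smul]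
    have h5 : g.1 = c • (s b).1 := by
      rw [← one_mul (s b).1, ← Matrix.smul_mul, ← hgc, mul_assoc, Units.inv_mul, mul_one]
    have hc0 : c ≠ 0 := by
      rintro rfl
      exact g.ne_zero (by rw [h5, zero_smul])
    exact ⟨b, (mk_eq_mk_of_val_eq_smul hc0 h5).symm⟩

end IsWeylFamily

/-! ### Isometry versus conjugacy -/

/-- A nonsingular symplectic abelian group realised by a Weyl family with image `K` is isometric
to `K`. -/
theorem FiniteMaximalDiagonalizable.isometric_of_range_eq {n : ℕ} [NeZero n]
    (K : FiniteMaximalDiagonalizable n) {H : SymplecticAbelianGroup} (hH : H.Nonsingular)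
    {t : H.carrier → GL (Fin n) ℂ} (ht : IsWeylFamily t H.pairing)
    (hK : ht.toHom.range = K.1) : K.toSymplectic.Isometric H := by
  have h1 (a : H.carrier) : ∃ x, K.incl x = ProjGenLinGroup.mk (t a) :=
    K.exists_incl_eq (hK ▸ ⟨a, rfl⟩)
  choose e he using h1
  have he' (a : H.carrier) : K.incl (e a) = ht.toHom a := he a
  let f : H.carrier →* K.toSymplectic.carrier := MonoidHom.mk' e fun a b =>
    K.incl_injective (by rw [map_mul, he', he', he', map_mul])
  have hf : Function.Bijective f := by
    constructor
    · intro a b hab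
      exact ht.toHom_injective hH (by rw [← he', ← he']; exact congrArg K.incl hab)
    · intro x
      obtain ⟨a, ha⟩ : K.incl x ∈ ht.toHom.range := hK ▸ K.incl_mem x
      exact ⟨a, K.incl_injective ((he' a).trans ha)⟩
  refine SymplecticAbelianGroup.Isometric.symm ⟨MulEquiv.ofBijective f hf, fun a b => ?_⟩
  apply scalar_injective (n := n)
  rw [← ht.commutator a b]
  exact (commutatorScalar_spec (K.incl (e a)) (K.incl (e b)) (K.mul_comm' (e a) (e b)) _ _
    (he a).symm (he b).symm).symm

theorem FiniteMaximalDiagonalizable.isometric_of_conj {n : ℕ} [NeZero n]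
    {K₁ K₂ : FiniteMaximalDiagonalizable n} {g : ProjGenLinGroup (Fin n) ℂ}
    (hg : K₁.1.map (MulAut.conj g).toMonoidHom = K₂.1) :
    K₁.toSymplectic.Isometric K₂.toSymplectic := by
  obtain ⟨P, rfl⟩ := ProjGenLinGroup.mk_surjective g
  refine (K₂.isometric_of_range_eq K₁.nonsingular (K₁.isWeylFamily.conj P) ?_).symm
  have h (a : K₁.toSymplectic.carrier) : (K₁.isWeylFamily.conj P).toHom a =
      MulAut.conj (ProjGenLinGroup.mk P) (K₁.incl a) := by
    rw [MulAut.conj_apply, ← K₁.mk_lift, ← map_inv, ← map_mul, ← map_mul]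
    rfl
  rw [← hg]
  ext x
  constructor
  · rintro ⟨a, rfl⟩
    exact ⟨_, K₁.incl_mem a, (h a).symm⟩
  · rintro ⟨y, hy, rfl⟩
    obtain ⟨a, rfl⟩ := K₁.exists_incl_eq hy
    exact ⟨a, h a⟩

/-- Transporting the lifts of K₂ along the isometry gives a second Weyl family for the pairing of
K₁, to which `IsWeylFamily.exists_conj` applies. -/
theorem FiniteMaximalDiagonalizable.exists_conj_of_isometric {n : ℕ} [NeZero n]
    {K₁ K₂ : FiniteMaximalDiagonalizable n}
    (h : K₁.toSymplectic.Isometric K₂.toSymplectic) :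
    ∃ g : ProjGenLinGroup (Fin n) ℂ, K₁.1.map (MulAut.conj g).toMonoidHom = K₂.1 := by
  obtain ⟨e, he⟩ := h
  have ht : IsWeylFamily (fun a => K₂.lift (e a)) K₁.toSymplectic.pairing :=
    ⟨fun a b => by rw [map_mul, K₂.isWeylFamily.mk_mul],
      fun a b => by rw [K₂.isWeylFamily.comm, he]⟩
  obtain ⟨P, hP⟩ := K₁.isWeylFamily.exists_conj ht K₁.hasScalarCommutant
    K₁.toSymplectic.pairing_antisymm K₁.nonsingular
  have hP' (a : K₁.toSymplectic.carrier) :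
      MulAut.conj (ProjGenLinGroup.mk P) (K₁.incl a) = K₂.incl (e a) := by
    rw [MulAut.conj_apply, ← K₁.mk_lift, ← K₂.mk_lift, ← hP, map_mul, map_mul, map_inv]
  refine ⟨ProjGenLinGroup.mk P, ?_⟩
  ext x
  constructor
  · rintro ⟨y, hy, rfl⟩
    obtain ⟨a, rfl⟩ := K₁.exists_incl_eq hy
    exact (hP' a).symm ▸ K₂.incl_mem (e a)
  · intro hx
    obtain ⟨b, rfl⟩ := K₂.exists_incl_eq hx
    refine ⟨_, K₁.incl_mem (e.symm b), ?_⟩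
    exact (hP' (e.symm b)).trans (by rw [e.apply_symm_apply])

/-! ### Construction of a Weyl family for a given pairing -/

/-- An alternating pairing on a finite abelian group is the antisymmetrization of a
bimultiplicative map. -/
theorem exists_antisymmetrization_eq {H : Type*} [CommGroup H] [Finite H] (ω : H →* H →* ℂˣ)
    (hself : ∀ a, ω a a = 1) (hanti : ∀ a b, ω a b = (ω b a)⁻¹) :
    ∃ β : H →* H →* ℂˣ, ∀ a b, β a b = ω a b * β b a := by
  classical
  obtain ⟨ι, _, N, -, ⟨e⟩⟩ := CommGroup.equiv_prod_multiplicative_zmod_of_finite H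
  let : LinearOrder ι := LinearOrder.lift' (Fintype.equivFin ι) (Fintype.equivFin ι).injective
  let ψ (i : ι) : Multiplicative (ZMod (N i)) →* H :=
    e.symm.toMonoidHom.comp (MonoidHom.mulSingle (fun i => Multiplicative (ZMod (N i))) i)
  let π (i : ι) : H →* H :=
    (ψ i).comp ((Pi.evalMonoidHom (fun i => Multiplicative (ZMod (N i))) i).comp e.toMonoidHom)
  have hprod (a : H) : ∏ i, π i a = a := by
    apply e.injective
    rw [map_prod]
    simp only [π, ψ, MonoidHom.comp_apply, MulEquiv.toMonoidHom_eq_coe, MonoidHom.coe_coe,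
      MulEquiv.apply_symm_apply, Pi.evalMonoidHom_apply, MonoidHom.mulSingle_apply]
    exact Finset.univ_prod_mulSingle (e a)
  -- Each factor is cyclic, so the alternating pairing is trivial on it.
  have hdiag (i : ι) (a b : H) : ω (π i a) (π i b) = 1 := by
    obtain ⟨g, hg⟩ := IsCyclic.exists_generator (α := Multiplicative (ZMod (N i)))
    obtain ⟨k, hk⟩ := hg (e a i)
    obtain ⟨l, hl⟩ := hg (e b i)
    have ha : π i a = ψ i g ^ k := by
      rw [← map_zpow]
      exact congrArg (ψ i) hk.symm
    have hb : π i b = ψ i g ^ l := by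
      rw [← map_zpow]
      exact congrArg (ψ i) hl.symm
    rw [ha, hb, map_zpow, map_zpow, MonoidHom.zpow_apply, hself, _root_.one_zpow,
      _root_.one_zpow]
  -- β keeps the strictly upper triangular part of ω with respect to the cyclic decomposition.
  let B (i j : ι) : H →* H →* ℂˣ := ((ω.comp (π i)).flip.comp (π j)).flip
  refine ⟨∏ i, ∏ j, if i < j then B i j else 1, fun a b => ?_⟩
  have happ (a b : H) : (∏ i, ∏ j, if i < j then B i j else 1) a b =
      ∏ i, ∏ j, if i < j then ω (π i a) (π j b) else 1 := by
    simp only [MonoidHom.finsetProd_apply]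
    refine Finset.prod_congr rfl fun i _ => Finset.prod_congr rfl fun j _ => ?_
    split_ifs <;> rfl
  have hω : ω a b = ∏ i, ∏ j, ω (π i a) (π j b) := by
    conv_lhs => rw [← hprod a, ← hprod b]
    simp only [map_prod, MonoidHom.finsetProd_apply]
    exact Finset.prod_comm
  rw [happ, happ, hω,
    Finset.prod_comm (γ := ι) (f := fun i j => if i < j then ω (π i b) (π j a) else 1),
    ← Finset.prod_mul_distrib]
  refine Finset.prod_congr rfl fun i _ => ?_
  rw [← Finset.prod_mul_distrib]
  refine Finset.prod_congr rfl fun j _ => ?_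
  rcases lt_trichotomy i j with h | rfl | h
  · rw [if_pos h, if_neg h.not_gt, mul_one]
  · rw [hdiag]
    simp
  · rw [if_neg h.not_gt, if_pos h, hanti (π j b) (π i a), mul_inv_cancel]

/-- A projective representation with a bimultiplicative cocycle `β` contains a Weyl family with
scalar commutant. -/
theorem exists_isWeylFamily_of_projective {H : Type u} [CommGroup H] {ω β : H →* H →* ℂˣ}
    (hβ : ∀ a b, β a b = ω a b * β b a) (d : ℕ) :
    ∀ {V : Type v} [AddCommGroup V] [Module ℂ V] [FiniteDimensional ℂ V] [Nontrivial V]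
      (_ : Module.finrank ℂ V = d) (U : H → Module.End ℂ V) (_ : U 1 = 1)
      (_ : ∀ a b, U a * U b = (β a b : ℂ) • U (a * b)),
      ∃ m : ℕ, m ≠ 0 ∧ ∃ s : H → GL (Fin m) ℂ, IsWeylFamily s ω ∧ HasScalarCommutant s := by
  induction d using Nat.strong_induction_on with
  | _ d ih =>
  intro V _ _ _ _ hd U hU1 hU
  by_cases hsc : ∀ X : Module.End ℂ V, (∀ a, U a * X = X * U a) → ∃ c : ℂ, X = c • 1
  · refine ⟨Module.finrank ℂ V, Module.finrank_pos.ne', ?_⟩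
    let b := Module.finBasis ℂ V
    let M := LinearMap.toMatrixAlgEquiv b
    -- The right inverse is also a left inverse because β(a, a⁻¹) = β(a⁻¹, a) = β(a, a)⁻¹.
    let w (a : H) : (Module.End ℂ V)ˣ := ⟨U a, ((β a a⁻¹)⁻¹ : ℂˣ).1 • U a⁻¹, by
      rw [mul_smul_comm, hU, smul_smul, Units.inv_mul, mul_inv_cancel, hU1, one_smul], by
      rw [smul_mul_assoc, hU, smul_smul, inv_mul_cancel, hU1]
      simp⟩
    let s (a : H) : GL (Fin (Module.finrank ℂ V)) ℂ := Units.map M.toRingEquiv.toMonoidHom (w a)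
    have hsv (a : H) : (s a).1 = M (U a) := rfl
    refine ⟨s, ⟨fun a c => ?_, fun a c => ?_⟩, fun X hX => ?_⟩
    · rw [← map_mul]
      refine (mk_eq_mk_of_val_eq_smul (c := β a c) (Units.ne_zero _) ?_).symm
      rw [Units.val_mul, hsv, hsv, hsv, ← map_mul, hU, map_smul]
    · rw [hsv, hsv, ← map_mul, ← map_mul, hU, hU, map_smul, map_smul, smul_smul, hβ a c,
        Units.val_mul, mul_comm c a]
    · obtain ⟨c, hc⟩ := hsc (M.symm X) fun a => by
        apply M.injective
        rw [map_mul, map_mul, M.apply_symm_apply]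
        exact hX a
      refine ⟨c, ?_⟩
      rw [← M.apply_symm_apply X, hc, map_smul, map_one]
  push Not at hsc
  obtain ⟨X, hX, hXc⟩ := hsc
  -- An eigenspace of a non-scalar X in the commutant is a smaller nonzero subrepresentation.
  obtain ⟨μ, hμ⟩ := Module.End.exists_eigenvalue X
  set W := Module.End.eigenspace X μ with hW
  have hWtop : W ≠ ⊤ := by
    intro h
    refine hXc μ (LinearMap.ext fun v => ?_)
    have : v ∈ W := h ▸ Submodule.mem_top
    exact Module.End.mem_eigenspace_iff.mp this
  have hinv (a : H) : ∀ v ∈ W, U a v ∈ W := by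
    intro v hv
    rw [hW, Module.End.mem_eigenspace_iff] at hv ⊢
    rw [← Module.End.mul_apply, ← hX a, Module.End.mul_apply, hv, map_smul]
  have : Nontrivial W := Submodule.nontrivial_iff_ne_bot.mpr hμ
  refine ih _ (hd ▸ Submodule.finrank_lt hWtop) (V := W) rfl
    (fun a => (U a).restrict (hinv a)) ?_ fun a c => ?_
  · ext v
    exact congrArg (fun f : Module.End ℂ V => f v) hU1
  · ext v
    exact congrArg (fun f : Module.End ℂ V => f v) (hU a c)

theorem exists_isWeylFamily {H : Type u} [CommGroup H] [Finite H] (ω : H →* H →* ℂˣ)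
    (hself : ∀ a, ω a a = 1) (hanti : ∀ a b, ω a b = (ω b a)⁻¹) :
    ∃ m : ℕ, m ≠ 0 ∧ ∃ s : H → GL (Fin m) ℂ, IsWeylFamily s ω ∧ HasScalarCommutant s := by
  obtain ⟨β, hβ⟩ := exists_antisymmetrization_eq ω hself hanti
  -- The regular representation twisted by β; bimultiplicativity gives β(x, a) β(xa, b) = β(a, b)
  -- β(x, ab).
  let U (a : H) : Module.End ℂ (H → ℂ) :=
    { toFun := fun f x => (β x a : ℂ) * f (x * a)
      map_add' := fun f g => by
        ext x
        simp [mul_add]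
      map_smul' := fun c f => by
        ext x
        simp [mul_left_comm] }
  refine exists_isWeylFamily_of_projective hβ _ rfl U ?_ fun a b => ?_
  · refine LinearMap.ext fun f => funext fun x => ?_
    simp [U]
  · refine LinearMap.ext fun f => funext fun x => ?_
    simp only [U, Module.End.mul_apply, LinearMap.coe_mk, AddHom.coe_mk, LinearMap.smul_apply,
      Pi.smul_apply, smul_eq_mul, map_mul, MonoidHom.mul_apply, Units.val_mul, mul_assoc]
    ring

theorem exists_finiteMaximalDiagonalizable_isometric {n : ℕ} [NeZero n]
    (H : SymplecticAbelianGroup.{u}) (hH : H.Nonsingular) (hcard : Nat.card H.carrier = n ^ 2) :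
    ∃ K : FiniteMaximalDiagonalizable n, K.toSymplectic.Isometric H := by
  have : Finite H.carrier := Nat.finite_of_card_ne_zero (by
    rw [hcard]
    exact pow_ne_zero _ (NeZero.ne n))
  have := Fintype.ofFinite H.carrier
  obtain ⟨m, hm, s, hs, hc⟩ := exists_isWeylFamily H.pairing H.pairing_self H.pairing_antisymm
  have : NeZero m := ⟨hm⟩
  -- The dimension is not controlled by the construction; counting gives m² = |H| = n².
  obtain rfl : m = n := by
    have h := hs.card_eq hc H.pairing_antisymm hH
    rw [← Nat.card_eq_fintype_card, hcard] at h
    exact (Nat.pow_left_injective two_ne_zero h).symm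
  let K : FiniteMaximalDiagonalizable m :=
    ⟨hs.toHom.range, hs.maximal_range hc H.pairing_antisymm hH,
      Set.finite_range hs.toHom⟩
  exact ⟨K, K.isometric_of_range_eq hH hs rfl⟩

/-! ### Change of universe and the bijection -/

theorem SymplecticAbelianGroup.Isometric.nonsingular {H₁ : SymplecticAbelianGroup.{u}}
    {H₂ : SymplecticAbelianGroup.{v}} (h : H₁.Isometric H₂) (h₁ : H₁.Nonsingular) :
    H₂.Nonsingular := by
  obtain ⟨e, he⟩ := h.symm
  intro a ha
  refine e.map_eq_one_iff.mp (h₁ _ fun b => ?_)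
  rw [← e.apply_symm_apply b, he, ha]

/-- Transitivity of isometry across universes. -/
theorem SymplecticAbelianGroup.isometric_trans {H₁ : SymplecticAbelianGroup}
    {H₂ : SymplecticAbelianGroup} {H₃ : SymplecticAbelianGroup} (h : H₁.Isometric H₂)
    (h' : H₂.Isometric H₃) : H₁.Isometric H₃ := by
  obtain ⟨e, he⟩ := h
  obtain ⟨e', he'⟩ := h'
  exact ⟨e.trans e', fun a b => by simp [he, he']⟩

/-- A copy of a symplectic abelian group in another universe. -/
def SymplecticAbelianGroup.ulift (H : SymplecticAbelianGroup.{v}) :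
    SymplecticAbelianGroup.{max u v} where
  carrier := ULift.{u} H.carrier
  pairing := ((H.pairing.comp
    (MulEquiv.ulift : ULift.{u} H.carrier ≃* H.carrier).toMonoidHom).flip.comp
      (MulEquiv.ulift : ULift.{u} H.carrier ≃* H.carrier).toMonoidHom).flip
  pairing_self a := H.pairing_self a.down

theorem SymplecticAbelianGroup.isometric_ulift (H : SymplecticAbelianGroup.{v}) :
    H.Isometric (ulift.{u} H) :=
  ⟨MulEquiv.ulift.symm, fun _ _ => rfl⟩

/-- The group `K` with its commutator pairing, as a nonsingular symplectic abelian group of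
order `n ^ 2` in an arbitrary universe. -/
noncomputable def FiniteMaximalDiagonalizable.toNonsingular {n : ℕ} [NeZero n]
    (K : FiniteMaximalDiagonalizable n) : NonsingularSymplecticOfOrder.{u} (n ^ 2) :=
  ⟨SymplecticAbelianGroup.ulift.{u} K.toSymplectic,
    K.toSymplectic.isometric_ulift.nonsingular K.nonsingular,
    (Nat.card_congr Equiv.ulift).trans K.card_eq⟩

theorem proposition5p4 (n : ℕ) [NeZero n] :
    (∀ K : FiniteMaximalDiagonalizable n,
      K.toSymplectic.Nonsingular ∧ Nat.card K.toSymplectic.carrier = n ^ 2) ∧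
    ∃ f : ConjugacyClasses n → IsometryClasses.{u} (n ^ 2),
      Function.Bijective f ∧
      ∀ (K : FiniteMaximalDiagonalizable n) (H : NonsingularSymplecticOfOrder.{u} (n ^ 2)),
        f (Quotient.mk (conjugacySetoid n) K) = Quotient.mk (isometrySetoid (n ^ 2)) H ↔
          K.toSymplectic.Isometric H.1 := by
  refine ⟨fun K => ⟨K.nonsingular, K.card_eq⟩, ?_⟩
  have hup (K : FiniteMaximalDiagonalizable n) :
      K.toSymplectic.Isometric K.toNonsingular.{u}.1 :=
    K.toSymplectic.isometric_ulift
  let f : ConjugacyClasses n → IsometryClasses.{u} (n ^ 2) :=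
    Quotient.lift (fun K => Quotient.mk (isometrySetoid (n ^ 2)) K.toNonsingular)
      fun K₁ K₂ ⟨_, hg⟩ => Quotient.sound (s := isometrySetoid (n ^ 2))
        (SymplecticAbelianGroup.isometric_trans
          (SymplecticAbelianGroup.isometric_trans (hup K₁).symm
          (FiniteMaximalDiagonalizable.isometric_of_conj hg)) (hup K₂))
  have hf (K : FiniteMaximalDiagonalizable n) (H : NonsingularSymplecticOfOrder.{u} (n ^ 2)) :
      f (Quotient.mk (conjugacySetoid n) K) = Quotient.mk (isometrySetoid (n ^ 2)) H ↔
        K.toSymplectic.Isometric H.1 := by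
    constructor
    · intro h
      exact SymplecticAbelianGroup.isometric_trans (hup K)
        (Quotient.exact (s := isometrySetoid (n ^ 2)) h)
    · intro h
      exact Quotient.sound (s := isometrySetoid (n ^ 2))
        (SymplecticAbelianGroup.isometric_trans (hup K).symm h)
  refine ⟨f, ⟨?_, ?_⟩, hf⟩
  · rintro ⟨K₁⟩ ⟨K₂⟩ h
    have h' := SymplecticAbelianGroup.isometric_trans ((hf K₁ K₂.toNonsingular).mp h) (hup K₂).symm
    exact Quotient.sound (s := conjugacySetoid n)
      (FiniteMaximalDiagonalizable.exists_conj_of_isometric h')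
  · rintro ⟨H⟩
    obtain ⟨K, hK⟩ := exists_finiteMaximalDiagonalizable_isometric H.1 H.2.1 H.2.2
    exact ⟨Quotient.mk (conjugacySetoid n) K, (hf K H).mpr hK⟩
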